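/- Let $S$ be an infinite set, let $D\ge 1$ be an integer, and let $V=S^D$. For a set $W$ let $\mathcal F(W)$ denote the set of finite subsets of $W$, and write $a+b=a\cup b$. A *set-polynomial* is a mapping $P:\mathcal F(S)\to\mathcal F(V)$ given by coefficients $P_\alpha\in\mathcal F(S^{\bar\alpha})$, $\alpha\subseteq\{1,\dots,D\}$, $\bar\alpha=\{1,\dots,D\}\setminus\alpha$, through $$P(n)=\bigcup_{\alpha\subseteq\{1,\dots,D\}}\{s\in V:\ (s_i)_{i\in\bar\alpha}\in P_\alpha\ \text{and}\ s_i\in n\ \text{for all } i\in\alpha\};$$ its constant term is $P_\emptyset=P(\emptyset)$. (Here $S^{\emptyset}$ is a one-point set.) An *action* of $\mathcal F(V)$ on a topological space $X$ is a mapping $a\mapsto T^a$ from $\mathcal F(V)$ to the continuous self-maps of $X$ such that $T^{a\cup b}=T^aT^b$ whenever $a\cap b=\emptyset$. Let $A$ be a finite set of set-polynomials, all of whose constant terms are empty. Then: 1. $A$ is a system of recurrence: for every compact metric space $(X,\rho)$, every action $T$ of $\mathcal F(V)$ on $X$, every $\varepsilon>0$ and every $H\in\mathcal F(S)$ there exists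 $N\in\mathcal F(S)$ with $N\cap H=\emptyset$ such that for every $x\in X$ there exist a nonempty $n\subseteq N$ and a set $a\subseteq\bigcup_{P\in A}P(N)$ such that, for all $P\in A$, $a\cap P(n)=\emptyset$ and $\rho(T^{a+P(n)}x,T^ax)<\varepsilon$. 2. (Chromatic form.) For every $k\in\mathbb N$ and every $H\in\mathcal F(S)$ there exists $N\in\mathcal F(S)$ with $N\cap H=\emptyset$ such that for every mapping $\omega:\mathcal F(V)\to\{1,\dots,k\}$ there exist a nonempty $n\subseteq N$ and a set $a\subseteq\bigcup_{P\in A}P(N)$ such that, for all $P\in A$, $a\cap P(n)=\emptyset$ and $\omega(a+P(n))=\omega(a)$. -/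

import Mathlib

universe u v

/-- A set-polynomial over `S` in dimension `D`, given by its coefficients: for each `α ⊆ {1, …, D}`
a finite subset of `S ^ ᾱ`, where `ᾱ` is the complement of `α`. -/
@[ext]
structure SetPolynomial (S : Type u) (D : ℕ) where
  coeff : (α : Finset (Fin D)) → Finset ({i : Fin D // i ∉ α} → S)

namespace SetPolynomial

variable {S : Type u} {D : ℕ}

/-- The `α`-term at `n`: the points `s ∈ S ^ D` whose restriction to the complement of `α` belongs
to the coefficient of `α` and whose coordinates in `α` belong to `n`. -/
def term (P : SetPolynomial S D) (α : Finset (Fin D)) (n : Finset S) : Set (Fin D → S) :=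
  {s | (fun i : {i : Fin D // i ∉ α} => s i) ∈ P.coeff α ∧ ∀ i ∈ α, s i ∈ n}

theorem finite_term (P : SetPolynomial S D) (α : Finset (Fin D)) (n : Finset S) :
    (P.term α n).Finite := by
  classical
  refine Set.Finite.of_injOn
    (f := fun s : Fin D → S =>
      ((fun i : {i : Fin D // i ∉ α} => s i), (fun i : {i : Fin D // i ∈ α} => s i)))
    (t := ((P.coeff α : Set _) ×ˢ
      (Fintype.piFinset (fun _ : {i : Fin D // i ∈ α} => n) : Set _))) ?_ ?_ ?_
  · rintro s ⟨h₁, h₂⟩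
    refine ⟨h₁, ?_⟩
    simpa using h₂
  · intro s _ t _ h
    funext i
    simp only [Prod.mk.injEq] at h
    by_cases hi : i ∈ α
    · exact congrFun h.2 ⟨i, hi⟩
    · exact congrFun h.1 ⟨i, hi⟩
  · exact (Finset.finite_toSet _).prod (Finset.finite_toSet _)

/-- The mapping `F(S) → F(S ^ D)` defined by a set-polynomial: the union of all its terms. -/
noncomputable def eval (P : SetPolynomial S D) (n : Finset S) : Finset (Fin D → S) :=
  (Set.finite_iUnion (fun α => P.finite_term α n)).toFinset

theorem mem_eval (P : SetPolynomial S D) (n : Finset S) (s : Fin D → S) :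
    s ∈ P.eval n ↔ ∃ α : Finset (Fin D),
      (fun i : {i : Fin D // i ∉ α} => s i) ∈ P.coeff α ∧ ∀ i ∈ α, s i ∈ n := by
  simp [eval, term]

/-- The constant term of a set-polynomial is empty. -/
def HasEmptyConstantTerm (P : SetPolynomial S D) : Prop :=
  P.coeff ∅ = ∅

end SetPolynomial

open Classical in
/-- An action of `F(W)`, the finite subsets of `W`, on `X` by continuous self-maps:
`T^(a ∪ b) = T^a ∘ T^b` is required for disjoint `a`, `b` only. -/
structure FinsetAction (W : Type u) (X : Type v) [TopologicalSpace X] where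
  act : Finset W → C(X, X)
  act_union : ∀ a b : Finset W, Disjoint a b → act (a ∪ b) = (act a).comp (act b)

open Classical in
/-- A finite system `A` of set-polynomials is a system of recurrence with respect to the
action `T`. -/
def IsRecurrentFor {S : Type u} {D : ℕ} (A : Finset (SetPolynomial S D))
    {X : Type v} [MetricSpace X] (T : FinsetAction (Fin D → S) X) : Prop :=
  ∀ ε : ℝ, 0 < ε → ∀ H : Finset S, ∃ N : Finset S, Disjoint N H ∧
    ∀ x : X, ∃ n : Finset S, n ⊆ N ∧ n.Nonempty ∧
      ∃ a : Finset (Fin D → S), a ⊆ A.biUnion (fun P => P.eval N) ∧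
        ∀ P ∈ A, Disjoint a (P.eval n) ∧
          dist (T.act (a ∪ P.eval n) x) (T.act a x) < ε

/-- A system of recurrence: recurrent for every action of `F(S ^ D)` on every compact metric
space. -/
def IsSystemOfRecurrence {S : Type u} {D : ℕ} (A : Finset (SetPolynomial S D)) : Prop :=
  ∀ (X : Type v) [MetricSpace X] [CompactSpace X] (T : FinsetAction (Fin D → S) X),
    IsRecurrentFor A T

open Classical in
/-- The combinatorial form of recurrence, for colorings of `F(S ^ D)` with `k` colors. -/
def IsColoringRecurrent {S : Type u} {D : ℕ} (A : Finset (SetPolynomial S D)) : Prop :=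
  ∀ (k : ℕ) (H : Finset S), ∃ N : Finset S, Disjoint N H ∧
    ∀ ω : Finset (Fin D → S) → Fin k, ∃ n : Finset S, n ⊆ N ∧ n.Nonempty ∧
      ∃ a : Finset (Fin D → S), a ⊆ A.biUnion (fun P => P.eval N) ∧
        ∀ P ∈ A, Disjoint a (P.eval n) ∧ ω (a ∪ P.eval n) = ω a

/-!
A finite subset of `S ^ D` is a word over `Bool` with positions in `S ^ D`, and adding `P(n)` to it
overwrites the positions that have a coordinate in `n`. The chromatic form therefore follows from a
polynomial Hales–Jewett theorem: every finite coloring of words has a monochromatic family of words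
obtained from a single word by overwriting it by the members of a system `𝒜` of polynomials and by a
reference polynomial `p₀`, all evaluated at the same nonempty set.

The proof is a PET induction. Adjoining subsets of a finite set to the argument derives from `𝒜` a
new system. If its reference polynomial comes from a member `p₁` of `𝒜` of least positive degree
relative to `p₀`, then passing to the derived system does not increase the number of leading parts
in higher degrees and lowers it in the degree of `p₁`. Color focusing reduces the theorem for `𝒜` to
the theorem for derived systems: each application of the latter adds a color to those already
focused at a word, until no color is left. The topological form follows by coloring `X` by a finite
cover by balls of radius `ε / 2`.
-/

theorem toColex_lt_toColex_of_le_of_lt {ι : Type*} {β : ι → Type*} [LinearOrder ι]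
    [WellFoundedGT ι] [∀ i, PartialOrder (β i)] {x y : ∀ i, β i} (i : ι)
    (hle : ∀ j, i < j → x j ≤ y j) (hlt : x i < y i) : toColex x < toColex y := by
  let z : ∀ i, β i := fun j => if i < j then y j else x j
  have hxz : x ≤ z := fun j => by
    by_cases hj : i < j
    · simpa only [z, if_pos hj] using hle j hj
    · simp only [z, if_neg hj, le_refl]
  have hzy : toColex z < toColex y := ⟨i, fun j hj => if_pos hj, by simpa [z] using hlt⟩
  exact (Pi.toColex_monotone hxz).trans_lt hzy

theorem extend_restrict_eq_piecewise {ι β : Type*} [DecidableEq ι] (s : Finset ι) (f g : ι → β) :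
    Function.extend Subtype.val (s.restrict f) g = s.piecewise f g := by
  funext i
  by_cases hi : i ∈ s
  · rw [Finset.piecewise_eq_of_mem _ _ _ hi]
    exact Subtype.val_injective.extend_apply (s.restrict f) g ⟨i, hi⟩
  · rw [Finset.piecewise_eq_of_notMem _ _ _ hi,
      Function.extend_apply' _ _ _ fun ⟨j, hj⟩ => hi (hj ▸ j.2)]

namespace PolynomialHalesJewett

open Finset

variable {S : Type u} {L : Type v} {D : ℕ}

section Pattern

/-- The cube `M ^ D` of positions all of whose coordinates belong to `M`. -/
def cube (D : ℕ) (M : Finset S) : Finset (Fin D → S) :=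
  Fintype.piFinset fun _ => M

/-- The patterns with constants in `M`; a pattern is a point of `(S ∪ {∗}) ^ D`, whose `∗`-entries,
encoded as `none`, are its variable coordinates. -/
def patterns (D : ℕ) (M : Finset S) : Finset (Fin D → Option S) :=
  Fintype.piFinset fun _ => insertNone M

/-- The degree of a pattern: the number of its variable coordinates. -/
def degree (v : Fin D → Option S) : ℕ := #{i | v i = none}

/-- The patterns with constants in `M` of degree `e`. -/
def patternsOfDegree (D : ℕ) (M : Finset S) (e : ℕ) : Finset (Fin D → Option S) :=
  {v ∈ patterns D M | degree v = e}

variable {M N Γ γ n : Finset S} {v : Fin D → Option S} {s : Fin D → S}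

theorem mem_cube : s ∈ cube D M ↔ ∀ i, s i ∈ M :=
  Fintype.mem_piFinset

theorem mem_patterns : v ∈ patterns D M ↔ ∀ i, ∀ x ∈ v i, x ∈ M := by
  simp only [patterns, Fintype.mem_piFinset, mem_insertNone]

theorem some_comp_mem_patterns : some ∘ s ∈ patterns D M ↔ s ∈ cube D M := by
  simp [mem_patterns, mem_cube]

theorem degree_le (v : Fin D → Option S) : degree v ≤ D :=
  (card_filter_le univ _).trans_eq (card_fin D)

variable [DecidableEq S]

/-- Let the constants of a pattern that belong to `n` vary: they are replaced by variables. -/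
def vary (n : Finset S) (v : Fin D → Option S) : Fin D → Option S :=
  fun i => (v i).filter (· ∉ n)

theorem vary_vary (n m : Finset S) (v : Fin D → Option S) :
    vary m (vary n v) = vary (n ∪ m) v := by
  funext i
  simp [vary, Option.filter_filter]

theorem vary_mem_patterns (hv : v ∈ patterns D (M ∪ N)) : vary N v ∈ patterns D M := by
  rw [mem_patterns] at hv ⊢
  intro i x hx
  obtain ⟨hxv, hxN⟩ : v i = some x ∧ x ∉ N := by simpa [vary] using hx
  exact (mem_union.mp (hv i x hxv)).resolve_right hxN

theorem vary_eq_self (hv : v ∈ patterns D M) (hMN : Disjoint M N) : vary N v = v := by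
  funext i
  rcases hvi : v i with _ | x
  · rw [vary, hvi, Option.filter_none]
  · have hxN : x ∉ N := Finset.disjoint_left.mp hMN (mem_patterns.mp hv i x hvi)
    simp [vary, hvi, hxN]

theorem degree_lt_degree_vary (hv : v ∈ patterns D (M ∪ N)) (hvM : v ∉ patterns D M) :
    degree v < degree (vary N v) := by
  obtain ⟨i, x, hx, hxM⟩ : ∃ i, ∃ x ∈ v i, x ∉ M := by simpa [mem_patterns] using hvM
  have hxN : x ∈ N := (mem_union.mp (mem_patterns.mp hv i x hx)).resolve_left hxM
  have hvi : v i = some x := hx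
  refine card_lt_card (Finset.ssubset_iff_of_subset (fun j hj => ?_) |>.mpr ⟨i, ?_, ?_⟩)
  · simp_all [vary]
  · simp [vary, hvi, hxN]
  · simp [hvi]

end Pattern

section Degree

variable [DecidableEq L] {M : Finset S} {p q : (Fin D → Option S) → L} {v : Fin D → Option S}

/-- The degree of `p - q`: the largest degree of a pattern with constants in `M` where `p` and `q`
differ. It is `0` when `p` and `q` agree on all patterns of positive degree, which are the only ones
that matter for overwriting. -/
def relDegree (M : Finset S) (p q : (Fin D → Option S) → L) : ℕ :=
  {v ∈ patterns D M | p v ≠ q v}.sup degree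

theorem degree_le_relDegree (hv : v ∈ patterns D M) (hpq : p v ≠ q v) :
    degree v ≤ relDegree M p q :=
  le_sup (f := degree) (mem_filter.mpr ⟨hv, hpq⟩)

theorem eq_of_relDegree_lt (hv : v ∈ patterns D M) (h : relDegree M p q < degree v) :
    p v = q v :=
  not_not.mp fun hpq => h.not_ge (degree_le_relDegree hv hpq)

theorem relDegree_le : relDegree M p q ≤ D :=
  Finset.sup_le fun v _ => degree_le v

theorem exists_degree_eq_relDegree (h : relDegree M p q ≠ 0) :
    ∃ v ∈ patterns D M, degree v = relDegree M p q ∧ p v ≠ q v := by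
  have hne : {v ∈ patterns D M | p v ≠ q v}.Nonempty := by
    rw [nonempty_iff_ne_empty]
    intro hempty
    exact h (by rw [relDegree, hempty, sup_empty, Nat.bot_eq_zero])
  obtain ⟨v, hv, hdeg⟩ := exists_mem_eq_sup _ hne degree
  obtain ⟨hvM, hpq⟩ := mem_filter.mp hv
  exact ⟨v, hvM, hdeg.symm, hpq⟩

/-- The leading part in degree `e`: the values on the patterns of degree `e`. -/
def leadingPart (M : Finset S) (e : ℕ) (p : (Fin D → Option S) → L) :
    patternsOfDegree D M e → L :=
  (patternsOfDegree D M e).restrict p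

theorem leadingPart_ne (h : relDegree M p q ≠ 0) :
    leadingPart M (relDegree M p q) p ≠ leadingPart M (relDegree M p q) q := by
  obtain ⟨v, hv, hdeg, hpq⟩ := exists_degree_eq_relDegree h
  exact fun heq => hpq (congrFun heq ⟨v, mem_filter.mpr ⟨hv, hdeg⟩⟩)

/-- The leading parts of the members of `𝒜` whose degree relative to `q` is `e`. -/
def leadingParts (M : Finset S) (𝒜 : Set ((Fin D → Option S) → L)) (q : (Fin D → Option S) → L)
    (e : ℕ) : Set (patternsOfDegree D M e → L) :=
  leadingPart M e '' {p ∈ 𝒜 | relDegree M p q = e}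

theorem leadingPart_notMem_leadingParts {𝒜 : Set ((Fin D → Option S) → L)} {e : ℕ} (he : e ≠ 0) :
    leadingPart M e q ∉ leadingParts M 𝒜 q e := by
  rintro ⟨p, ⟨-, rfl⟩, heq⟩
  exact leadingPart_ne he heq

/-- The weight of `𝒜` relative to `q`: the number of leading parts in each degree. Weights are
compared colexicographically, that is, at the highest degree where they differ. -/
noncomputable def weight (M : Finset S) (𝒜 : Set ((Fin D → Option S) → L))
    (q : (Fin D → Option S) → L) : Fin (D + 1) → ℕ :=
  fun e => (leadingParts M 𝒜 q e).ncard

end Degree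

section Derive

variable [DecidableEq S] {M N Γ : Finset S} {p p₀ p₁ : (Fin D → Option S) → L}

/-- The polynomial `n ↦ p (n ∪ Γ)`, where the elements of `N ⊇ Γ` become constants. Patterns with a
constant in `N \ Γ` do not meet `n ∪ Γ`; there the reference polynomial `p₀` is evaluated, at
`n ∪ N`. -/
def derive (p₀ : (Fin D → Option S) → L) (N Γ : Finset S) (p : (Fin D → Option S) → L) :
    (Fin D → Option S) → L :=
  fun v => (if vary Γ v = vary N v then p else p₀) (vary N v)

theorem derive_self (p₀ : (Fin D → Option S) → L) (N Γ : Finset S) :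
    derive p₀ N Γ p₀ = p₀ ∘ vary N := by
  funext v
  rw [derive, ite_self, Function.comp_apply]

/-- The system of the polynomials derived from members of `𝒜` by adjoining subsets of `N` to the
argument. -/
def derivedSystem (p₀ : (Fin D → Option S) → L) (N : Finset S)
    (𝒜 : Set ((Fin D → Option S) → L)) : Set ((Fin D → Option S) → L) :=
  Set.image2 (derive p₀ N) {Γ | Γ ⊆ N} 𝒜

variable [DecidableEq L]

theorem derive_apply_of_relDegree_le (hMN : Disjoint M N) (hΓ : Γ ⊆ N) {v : Fin D → Option S}
    (hv : v ∈ patterns D (M ∪ N)) (hdeg : relDegree M p p₀ ≤ degree v) :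
    derive p₀ N Γ p v = (patterns D M).piecewise p (p₀ ∘ vary N) v := by
  by_cases hvM : v ∈ patterns D M
  · rw [piecewise_eq_of_mem _ _ _ hvM, derive, vary_eq_self hvM hMN,
      vary_eq_self hvM (hMN.mono_right hΓ), if_pos rfl]
  · have hp : p (vary N v) = p₀ (vary N v) := eq_of_relDegree_lt (vary_mem_patterns hv)
      (hdeg.trans_lt (degree_lt_degree_vary hv hvM))
    rw [piecewise_eq_of_notMem _ _ _ hvM, derive, ite_apply, hp, ite_self, Function.comp_apply]

theorem relDegree_derive {Γ₁ : Finset S} (hMN : Disjoint M N) (hΓ : Γ ⊆ N) (hΓ₁ : Γ₁ ⊆ N)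
    (hp : relDegree M p₁ p₀ ≤ relDegree M p p₀)
    (hle : relDegree M p₁ p₀ ≤ relDegree (M ∪ N) (derive p₀ N Γ p) (derive p₀ N Γ₁ p₁))
    (hne : relDegree (M ∪ N) (derive p₀ N Γ p) (derive p₀ N Γ₁ p₁) ≠ 0) :
    relDegree (M ∪ N) (derive p₀ N Γ p) (derive p₀ N Γ₁ p₁) = relDegree M p p₀ := by
  apply le_antisymm
  · obtain ⟨v, hv, hdeg, hdiff⟩ := exists_degree_eq_relDegree hne
    by_contra! hlt
    rw [← hdeg] at hle hlt
    apply hdiff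
    rw [derive_apply_of_relDegree_le hMN hΓ hv hlt.le, derive_apply_of_relDegree_le hMN hΓ₁ hv hle]
    by_cases hvM : v ∈ patterns D M
    · simp only [piecewise_eq_of_mem _ _ _ hvM]
      rw [eq_of_relDegree_lt hvM hlt, eq_of_relDegree_lt hvM (hp.trans_lt hlt)]
    · simp only [piecewise_eq_of_notMem _ _ _ hvM]
  · rcases hp.eq_or_lt with heq | hlt
    · exact heq ▸ hle
    obtain ⟨v, hvM, hdeg, hdiff⟩ := exists_degree_eq_relDegree (Nat.ne_zero_of_lt hlt)
    have hv : v ∈ patterns D (M ∪ N) :=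
      mem_patterns.mpr fun i x hx => mem_union_left _ (mem_patterns.mp hvM i x hx)
    rw [← hdeg]
    rw [← hdeg] at hlt
    refine degree_le_relDegree hv ?_
    rw [derive_apply_of_relDegree_le hMN hΓ hv hdeg.ge,
      derive_apply_of_relDegree_le hMN hΓ₁ hv hlt.le, piecewise_eq_of_mem _ _ _ hvM,
      piecewise_eq_of_mem _ _ _ hvM, eq_of_relDegree_lt hvM hlt]
    exact hdiff

/-- The leading part of a derived polynomial in terms of that of the original one. -/
noncomputable def liftLeadingPart (p₀ : (Fin D → Option S) → L) (M N : Finset S) (e : ℕ)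
    (k : patternsOfDegree D M e → L) : patternsOfDegree D (M ∪ N) e → L :=
  (patternsOfDegree D (M ∪ N) e).restrict (Function.extend Subtype.val k (p₀ ∘ vary N))

theorem leadingPart_derive (hMN : Disjoint M N) (hΓ : Γ ⊆ N) {e : ℕ} (he : relDegree M p p₀ = e) :
    leadingPart (M ∪ N) e (derive p₀ N Γ p) = liftLeadingPart p₀ M N e (leadingPart M e p) := by
  funext ⟨v, hv⟩
  obtain ⟨hvMN, hdeg⟩ := mem_filter.mp hv
  have hmem : v ∈ patternsOfDegree D M e ↔ v ∈ patterns D M := by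
    rw [patternsOfDegree, mem_filter, and_iff_left hdeg]
  rw [leadingPart, liftLeadingPart, leadingPart, extend_restrict_eq_piecewise, restrict, restrict,
    derive_apply_of_relDegree_le hMN hΓ hvMN (he.trans hdeg.symm).le, Finset.piecewise,
    Finset.piecewise, if_congr hmem rfl rfl]

variable {𝒜 : Set ((Fin D → Option S) → L)}

theorem leadingParts_derivedSystem_subset (hMN : Disjoint M N) {e : ℕ}
    (hle : relDegree M p₁ p₀ ≤ e) (he : e ≠ 0) :
    leadingParts (M ∪ N) (derivedSystem p₀ N {p ∈ 𝒜 | relDegree M p₁ p₀ ≤ relDegree M p p₀})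
      (derive p₀ N ∅ p₁) e ⊆ liftLeadingPart p₀ M N e '' leadingParts M 𝒜 p₀ e := by
  rintro _ ⟨_, ⟨⟨Γ, hΓ, p, ⟨hp, hdeg⟩, rfl⟩, rfl⟩, rfl⟩
  have hpe := relDegree_derive hMN hΓ (empty_subset N) hdeg hle he
  exact ⟨_, ⟨p, ⟨hp, hpe.symm⟩, rfl⟩, (leadingPart_derive hMN hΓ hpe.symm).symm⟩

theorem weight_derivedSystem_lt [Finite L] (hMN : Disjoint M N) (hp₁ : p₁ ∈ 𝒜)
    (hne : relDegree M p₁ p₀ ≠ 0) :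
    toColex (weight (M ∪ N)
        (derivedSystem p₀ N {p ∈ 𝒜 | relDegree M p₁ p₀ ≤ relDegree M p p₀})
        (derive p₀ N ∅ p₁)) < toColex (weight M 𝒜 p₀) := by
  refine toColex_lt_toColex_of_le_of_lt ⟨relDegree M p₁ p₀, Nat.lt_succ_of_le relDegree_le⟩
    (fun e he => ?_) ?_
  · have hlt : relDegree M p₁ p₀ < e := he
    exact (Set.ncard_le_ncard (leadingParts_derivedSystem_subset hMN hlt.le (Nat.ne_zero_of_lt hlt))
      (Set.toFinite _)).trans (Set.ncard_image_le (Set.toFinite _))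
  · set e := relDegree M p₁ p₀ with he
    have hsub : leadingParts (M ∪ N) (derivedSystem p₀ N {p ∈ 𝒜 | e ≤ relDegree M p p₀})
        (derive p₀ N ∅ p₁) e ⊆
          liftLeadingPart p₀ M N e '' (leadingParts M 𝒜 p₀ e \ {leadingPart M e p₁}) := by
      intro k hk
      obtain ⟨l, hl, rfl⟩ := leadingParts_derivedSystem_subset hMN he.ge hne hk
      refine ⟨l, ⟨hl, ?_⟩, rfl⟩
      rintro rfl
      rw [← leadingPart_derive hMN (empty_subset N) he.symm] at hk
      exact leadingPart_notMem_leadingParts hne hk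
    calc _ ≤ (leadingParts M 𝒜 p₀ e \ {leadingPart M e p₁}).ncard :=
          (Set.ncard_le_ncard hsub (Set.toFinite _)).trans (Set.ncard_image_le (Set.toFinite _))
      _ < (leadingParts M 𝒜 p₀ e).ncard :=
          Set.ncard_sdiff_singleton_lt_of_mem ⟨p₁, ⟨hp₁, he.symm⟩, rfl⟩ (Set.toFinite _)

end Derive

section Overwrite

variable [DecidableEq S] {M N Γ γ n : Finset S} {p p₀ : (Fin D → Option S) → L}
  {u w : (Fin D → S) → L} {s : Fin D → S}

/-- The positions with coordinates in `M ∪ n`, not all of them in `M`. -/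
def cell (D : ℕ) (M n : Finset S) : Finset (Fin D → S) :=
  cube D (M ∪ n) \ cube D M

/-- Overwrite the word `w` by the polynomial `p` evaluated at `n`: a position of the cell of `n`
receives the letter that `p` gives to its pattern, whose variables are the coordinates in `n`. -/
def overwrite (M : Finset S) (p : (Fin D → Option S) → L) (n : Finset S) (w : (Fin D → S) → L) :
    (Fin D → S) → L :=
  (cell D M n).piecewise (fun s => p (vary n (some ∘ s))) w

theorem overwrite_apply_of_mem (hs : s ∈ cell D M n) :
    overwrite M p n w s = p (vary n (some ∘ s)) :=
  piecewise_eq_of_mem _ _ _ hs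

theorem overwrite_apply_of_notMem (hs : s ∉ cell D M n) : overwrite M p n w s = w s :=
  piecewise_eq_of_notMem _ _ _ hs

theorem overwrite_empty : overwrite M p ∅ w = w :=
  funext fun _ => overwrite_apply_of_notMem (by simp [cell])

theorem overwrite_eq_of_relDegree_eq_zero [DecidableEq L] (h : relDegree M p p₀ = 0) :
    overwrite M p n w = overwrite M p₀ n w := by
  refine piecewise_congr _ (fun s hs => ?_) fun _ _ => rfl
  simp only [cell, mem_sdiff, ← some_comp_mem_patterns] at hs
  refine eq_of_relDegree_lt (vary_mem_patterns hs.1) ?_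
  rw [h]
  exact Nat.zero_lt_of_lt (degree_lt_degree_vary hs.1 hs.2)

theorem overwrite_piecewise_cube (hn : n ⊆ N) :
    overwrite M p n ((cube D (M ∪ N)).piecewise u w) =
      (cube D (M ∪ N)).piecewise (overwrite M p n u) w := by
  have hsub : cell D M n ⊆ cube D (M ∪ N) := sdiff_subset.trans <|
    Fintype.piFinset_subset _ _ fun _ => union_subset_union_right hn
  funext s
  by_cases hs : s ∈ cell D M n
  · simp only [overwrite, piecewise_eq_of_mem _ _ _ hs, piecewise_eq_of_mem _ _ _ (hsub hs)]
  · by_cases hs' : s ∈ cube D (M ∪ N) <;> simp [overwrite, hs, hs']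

theorem overwrite_union_apply_of_mem_cube (hγ : Disjoint (M ∪ N) γ) (hs : s ∈ cube D (M ∪ N)) :
    overwrite M p (Γ ∪ γ) u s = overwrite M p Γ u s := by
  have hsγ : ∀ i, s i ∉ γ := fun i => Finset.disjoint_left.mp hγ (mem_cube.mp hs i)
  have hcell : s ∈ cell D M (Γ ∪ γ) ↔ s ∈ cell D M Γ := by
    simp only [cell, mem_sdiff, mem_cube, mem_union, hsγ, or_false]
  have hvary : vary (Γ ∪ γ) (some ∘ s) = vary Γ (some ∘ s) := by
    rw [union_comm, ← vary_vary, vary_eq_self (some_comp_mem_patterns.mpr hs) hγ]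
  simp only [overwrite, Finset.piecewise, hcell, hvary]

theorem mem_cube_union_iff_vary_eq (hMN : Disjoint M N) (hΓ : Γ ⊆ N)
    (hs : s ∈ cube D (M ∪ N ∪ γ)) :
    s ∈ cube D (M ∪ (Γ ∪ γ)) ↔
      vary Γ (vary γ (some ∘ s)) = vary N (vary γ (some ∘ s)) := by
  simp only [mem_cube, vary_vary, funext_iff]
  refine forall_congr' fun i => ?_
  have hsi := mem_cube.mp hs i
  have hMN' : s i ∈ M → s i ∉ N := fun h => Finset.disjoint_left.mp hMN h
  have hΓN : s i ∈ Γ → s i ∈ N := fun h => hΓ h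
  simp only [vary, Function.comp_apply, Option.filter_some, mem_union] at hsi ⊢
  grind

theorem overwrite_union_piecewise_cube (hMN : Disjoint M N) (hΓ : Γ ⊆ N)
    (hγ : Disjoint (M ∪ N) γ) :
    overwrite M p (Γ ∪ γ) ((cube D (M ∪ N)).piecewise u (overwrite (M ∪ N) (p₀ ∘ vary N) γ w)) =
      (cube D (M ∪ N)).piecewise (overwrite M p Γ u)
        (overwrite (M ∪ N) (derive p₀ N Γ p) γ w) := by
  funext s
  by_cases hs : s ∈ cube D (M ∪ N)
  · rw [overwrite_union_apply_of_mem_cube hγ hs, overwrite_piecewise_cube hΓ]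
    simp only [piecewise_eq_of_mem _ _ _ hs]
  have hsM : s ∉ cube D M := fun h => hs <|
    Fintype.piFinset_subset _ _ (fun _ => subset_union_left) h
  rw [piecewise_eq_of_notMem _ _ _ hs]
  by_cases hsγ : s ∈ cube D (M ∪ N ∪ γ)
  · have hiff := mem_cube_union_iff_vary_eq hMN hΓ hsγ
    rw [overwrite_apply_of_mem (mem_sdiff.mpr ⟨hsγ, hs⟩), derive]
    by_cases h : vary Γ (vary γ (some ∘ s)) = vary N (vary γ (some ∘ s))
    · rw [overwrite_apply_of_mem (mem_sdiff.mpr ⟨hiff.mpr h, hsM⟩), if_pos h, ← h, vary_vary,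
        union_comm]
    · rw [overwrite_apply_of_notMem fun hc => h (hiff.mp (mem_sdiff.mp hc).1),
        piecewise_eq_of_notMem _ _ _ hs, overwrite_apply_of_mem (mem_sdiff.mpr ⟨hsγ, hs⟩),
        if_neg h, Function.comp_apply]
  · have hsub : cube D (M ∪ (Γ ∪ γ)) ⊆ cube D (M ∪ N ∪ γ) := Fintype.piFinset_subset _ _ fun _ => by
      rw [← union_assoc]
      exact union_subset_union_left (union_subset_union_right hΓ)
    rw [overwrite_apply_of_notMem fun hc => hsγ (hsub (mem_sdiff.mp hc).1),
      piecewise_eq_of_notMem _ _ _ hs, overwrite_apply_of_notMem fun hc => hsγ (mem_sdiff.mp hc).1,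
      overwrite_apply_of_notMem fun hc => hsγ (mem_sdiff.mp hc).1]

end Overwrite

section Focusing

variable {K : Type*} [DecidableEq S] {M N N' Γ γ : Finset S} {p₀ q : (Fin D → Option S) → L}
  {𝒜 : Set ((Fin D → Option S) → L)} {ω : ((Fin D → S) → L) → K} {y w : (Fin D → S) → L} {c : K}

/-- For some word and some nonempty `n ⊆ N`, the coloring `ω` is constant on the results of
overwriting the word by `p₀` and by the members of `𝒜`, all evaluated at `n`. -/
def HasMonochromaticFamily (M N : Finset S) (p₀ : (Fin D → Option S) → L)
    (𝒜 : Set ((Fin D → Option S) → L)) (ω : ((Fin D → S) → L) → K) : Prop :=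
  ∃ (w : (Fin D → S) → L) (n : Finset S), n ⊆ N ∧ n.Nonempty ∧
    ∀ p ∈ 𝒜, ω (overwrite M p n w) = ω (overwrite M p₀ n w)

/-- The system is partition regular if, for every finite coloring of words, a monochromatic family
occurs within a finite set of new elements depending on the set of colors only. -/
def IsPartitionRegular (M : Finset S) (p₀ : (Fin D → Option S) → L)
    (𝒜 : Set ((Fin D → Option S) → L)) : Prop :=
  ∀ (K : Type (max u v)) [Finite K], ∃ N : Finset S, Disjoint M N ∧
    ∀ ω : ((Fin D → S) → L) → K, HasMonochromaticFamily M N p₀ 𝒜 ω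

/-- A spoke of color `c` with focus `y`: evaluated at `n`, the members of `𝒜` take `y` to words of
color `c`, while `p₀` fixes `y`. -/
def IsSpoke (M n : Finset S) (p₀ : (Fin D → Option S) → L) (𝒜 : Set ((Fin D → Option S) → L))
    (ω : ((Fin D → S) → L) → K) (y : (Fin D → S) → L) (c : K) : Prop :=
  overwrite M p₀ n y = y ∧ ∀ p ∈ 𝒜, ω (overwrite M p n y) = c

/-- The colors of `C` are focused at `y`: each of them is the color of a spoke within `N`. -/
def IsFocused (M N : Finset S) (p₀ : (Fin D → Option S) → L) (𝒜 : Set ((Fin D → Option S) → L))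
    (ω : ((Fin D → S) → L) → K) (y : (Fin D → S) → L) (C : Finset K) : Prop :=
  ∀ c ∈ C, ∃ n ⊆ N, n.Nonempty ∧ IsSpoke M n p₀ 𝒜 ω y c

theorem isSpoke_empty : IsSpoke M ∅ p₀ 𝒜 ω y (ω y) :=
  ⟨overwrite_empty, fun _ _ => by rw [overwrite_empty]⟩

theorem IsFocused.hasMonochromaticFamily {C : Finset K} (h : IsFocused M N p₀ 𝒜 ω y C)
    (hy : ω y ∈ C) : HasMonochromaticFamily M N p₀ 𝒜 ω := by
  obtain ⟨n, hnN, hn, hfix, hcolor⟩ := h _ hy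
  exact ⟨y, n, hnN, hn, fun p hp => by rw [hcolor p hp, hfix]⟩

theorem HasMonochromaticFamily.of_piecewise
    (h : HasMonochromaticFamily M N p₀ 𝒜 fun u => ω ((cube D (M ∪ N)).piecewise u w)) :
    HasMonochromaticFamily M (N ∪ N') p₀ 𝒜 ω := by
  obtain ⟨u, n, hnN, hn, hu⟩ := h
  refine ⟨(cube D (M ∪ N)).piecewise u w, n, hnN.trans subset_union_left, hn, fun p hp => ?_⟩
  rw [overwrite_piecewise_cube hnN, overwrite_piecewise_cube hnN]
  exact hu p hp

theorem exists_forall_eq_of_derivedSystem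
    (h : ∀ ω : ((Fin D → S) → L) → (cube D (M ∪ N) → L) → K,
      HasMonochromaticFamily (M ∪ N) N' q (derivedSystem p₀ N 𝒜) ω)
    (ω : ((Fin D → S) → L) → K) :
    ∃ (w : (Fin D → S) → L) (γ : Finset S), γ ⊆ N' ∧ γ.Nonempty ∧ ∀ Γ ⊆ N, ∀ p ∈ 𝒜, ∀ u,
      ω ((cube D (M ∪ N)).piecewise u (overwrite (M ∪ N) (derive p₀ N Γ p) γ w)) =
        ω ((cube D (M ∪ N)).piecewise u (overwrite (M ∪ N) q γ w)) := by
  obtain ⟨w, γ, hγN', hγ, hw⟩ := h fun w u => ω (Function.extend Subtype.val u w)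
  refine ⟨w, γ, hγN', hγ, fun Γ hΓ p hp u => ?_⟩
  simpa only [extend_restrict_eq_piecewise] using
    congrFun (hw _ ⟨Γ, hΓ, p, hp, rfl⟩) ((cube D (M ∪ N)).restrict u)

theorem IsSpoke.union {ω' : ((Fin D → S) → L) → K} (hMN : Disjoint M N)
    (hγ : Disjoint (M ∪ N) γ) (hΓ : Γ ⊆ N)
    (hω' : ∀ p ∈ 𝒜, ∀ u,
      ω ((cube D (M ∪ N)).piecewise u (overwrite (M ∪ N) (derive p₀ N Γ p) γ w)) = ω' u)
    (h : IsSpoke M Γ p₀ 𝒜 ω' y c) :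
    IsSpoke M (Γ ∪ γ) p₀ 𝒜 ω
      ((cube D (M ∪ N)).piecewise y (overwrite (M ∪ N) (p₀ ∘ vary N) γ w)) c := by
  refine ⟨?_, fun p hp => ?_⟩
  · rw [overwrite_union_piecewise_cube hMN hΓ hγ, h.1, derive_self]
  · rw [overwrite_union_piecewise_cube hMN hΓ hγ, hω' p hp, h.2 p hp]

theorem hasMonochromaticFamily_or_isFocused_succ {t : ℕ} (hMN : Disjoint M N)
    (hMNN' : Disjoint (M ∪ N) N')
    (hN : ∀ ω : ((Fin D → S) → L) → K, HasMonochromaticFamily M N p₀ 𝒜 ω ∨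
      ∃ y C, #C = t ∧ IsFocused M N p₀ 𝒜 ω y C)
    (hN' : ∀ ω : ((Fin D → S) → L) → (cube D (M ∪ N) → L) → K,
      HasMonochromaticFamily (M ∪ N) N' q (derivedSystem p₀ N 𝒜) ω)
    (ω : ((Fin D → S) → L) → K) :
    HasMonochromaticFamily M (N ∪ N') p₀ 𝒜 ω ∨
      ∃ y C, #C = t + 1 ∧ IsFocused M (N ∪ N') p₀ 𝒜 ω y C := by
  classical
  obtain ⟨w, γ, hγN', hγ, hw⟩ := exists_forall_eq_of_derivedSystem hN' ω
  let ω' : ((Fin D → S) → L) → K := fun u =>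
    ω ((cube D (M ∪ N)).piecewise u (overwrite (M ∪ N) q γ w))
  rcases hN ω' with hmono | ⟨y, C, hC, hfoc⟩
  · exact Or.inl hmono.of_piecewise
  by_cases hy : ω' y ∈ C
  · exact Or.inl (hfoc.hasMonochromaticFamily hy).of_piecewise
  let y' := (cube D (M ∪ N)).piecewise y (overwrite (M ∪ N) (p₀ ∘ vary N) γ w)
  have extend_spoke {Γ : Finset S} {c : K} (hΓ : Γ ⊆ N) (h : IsSpoke M Γ p₀ 𝒜 ω' y c) :
      ∃ n ⊆ N ∪ N', n.Nonempty ∧ IsSpoke M n p₀ 𝒜 ω y' c :=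
    ⟨Γ ∪ γ, union_subset_union hΓ hγN', hγ.inr,
      h.union hMN (hMNN'.mono_right hγN') hΓ (hw Γ hΓ)⟩
  refine Or.inr ⟨y', insert (ω' y) C, by rw [card_insert_of_notMem hy, hC], fun c hc => ?_⟩
  rcases mem_insert.mp hc with rfl | hc
  · exact extend_spoke (empty_subset N) isSpoke_empty
  · obtain ⟨Γ, hΓ, -, hspoke⟩ := hfoc c hc
    exact extend_spoke hΓ hspoke

theorem exists_hasMonochromaticFamily_or_isFocused [Finite L] (K : Type (max u v)) [Finite K]
    (h : ∀ N, Disjoint M N → ∃ q, IsPartitionRegular (M ∪ N) q (derivedSystem p₀ N 𝒜)) (t : ℕ) :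
    ∃ N, Disjoint M N ∧ ∀ ω : ((Fin D → S) → L) → K,
      HasMonochromaticFamily M N p₀ 𝒜 ω ∨ ∃ y C, #C = t ∧ IsFocused M N p₀ 𝒜 ω y C := by
  induction t with
  | zero =>
    exact ⟨∅, disjoint_empty_right M, fun ω => Or.inr
      ⟨fun _ => p₀ fun _ => none, ∅, card_empty, fun c hc => absurd hc (notMem_empty c)⟩⟩
  | succ t ih =>
    obtain ⟨N, hMN, hN⟩ := ih
    obtain ⟨q, hq⟩ := h N hMN
    obtain ⟨N', hMNN', hN'⟩ := hq ((cube D (M ∪ N) → L) → K)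
    exact ⟨N ∪ N', disjoint_union_right.mpr ⟨hMN, hMNN'.mono_left subset_union_left⟩,
      hasMonochromaticFamily_or_isFocused_succ hMN hMNN' hN hN'⟩

theorem isPartitionRegular_of_derivedSystem [Finite L]
    (h : ∀ N, Disjoint M N → ∃ q, IsPartitionRegular (M ∪ N) q (derivedSystem p₀ N 𝒜)) :
    IsPartitionRegular M p₀ 𝒜 := by
  intro K _
  have := Fintype.ofFinite K
  obtain ⟨N, hMN, hN⟩ := exists_hasMonochromaticFamily_or_isFocused K h (Fintype.card K + 1)
  refine ⟨N, hMN, fun ω => (hN ω).resolve_right ?_⟩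
  rintro ⟨y, C, hC, -⟩
  exact (Nat.lt_of_succ_le hC.ge).not_ge (card_le_univ C)

theorem isPartitionRegular_empty [Infinite S] : IsPartitionRegular M p₀ ∅ := by
  intro K _
  obtain ⟨x, hx⟩ := Infinite.exists_notMem_finset M
  exact ⟨{x}, disjoint_singleton_right.mpr hx, fun _ => ⟨fun _ => p₀ fun _ => none, {x},
    Subset.rfl, singleton_nonempty x, fun p hp => hp.elim⟩⟩

theorem IsPartitionRegular.of_relDegree_ne_zero [DecidableEq L] {ℬ : Set ((Fin D → Option S) → L)}
    (h : IsPartitionRegular M p₀ ℬ) (hℬ : ∀ p ∈ 𝒜, relDegree M p p₀ ≠ 0 → p ∈ ℬ) :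
    IsPartitionRegular M p₀ 𝒜 := by
  intro K _
  obtain ⟨N, hMN, hN⟩ := h K
  refine ⟨N, hMN, fun ω => ?_⟩
  obtain ⟨w, n, hnN, hn, hw⟩ := hN ω
  refine ⟨w, n, hnN, hn, fun p hp => ?_⟩
  by_cases hdeg : relDegree M p p₀ = 0
  · rw [overwrite_eq_of_relDegree_eq_zero hdeg]
  · exact hw p (hℬ p hp hdeg)

theorem isPartitionRegular [Infinite S] [Finite L] (M : Finset S) (p₀ : (Fin D → Option S) → L)
    (𝒜 : Set ((Fin D → Option S) → L)) : IsPartitionRegular M p₀ 𝒜 := by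
  classical
  induction hx : toColex (weight M 𝒜 p₀) using WellFoundedLT.induction generalizing M p₀ 𝒜 with
  | _ x ih =>
  subst hx
  by_cases hdeg : ∃ p ∈ 𝒜, relDegree M p p₀ ≠ 0
  · obtain ⟨p₁, ⟨hp₁, hne⟩, hmin⟩ := exists_minimalFor_of_wellFoundedLT
      (fun p => p ∈ 𝒜 ∧ relDegree M p p₀ ≠ 0) (fun p => relDegree M p p₀) hdeg
    have hsep : IsPartitionRegular M p₀ {p ∈ 𝒜 | relDegree M p₁ p₀ ≤ relDegree M p p₀} :=
      isPartitionRegular_of_derivedSystem fun N hMN =>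
        ⟨derive p₀ N ∅ p₁, ih _ (weight_derivedSystem_lt hMN hp₁ hne) _ _ _ rfl⟩
    exact hsep.of_relDegree_ne_zero fun p hp hp0 => ⟨hp, (le_total _ _).elim id (hmin ⟨hp, hp0⟩)⟩
  · exact isPartitionRegular_empty.of_relDegree_ne_zero fun p hp hp0 => hdeg ⟨p, hp, hp0⟩

end Focusing

end PolynomialHalesJewett

namespace SetPolynomial

open Finset PolynomialHalesJewett

variable {S : Type u} {D : ℕ}

theorem eval_mono (P : SetPolynomial S D) : Monotone P.eval := by
  intro m n hmn s hs
  obtain ⟨α, hcoeff, hα⟩ := (P.mem_eval m s).mp hs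
  exact (P.mem_eval n s).mpr ⟨α, hcoeff, fun i hi => hmn (hα i hi)⟩

open Classical in
/-- The elements of `S` occurring as coordinates in the coefficients of a set-polynomial. -/
noncomputable def support (P : SetPolynomial S D) : Finset S :=
  univ.biUnion fun α => (P.coeff α).biUnion fun c => univ.image c

theorem mem_support {P : SetPolynomial S D} {α : Finset (Fin D)}
    {c : {i : Fin D // i ∉ α} → S} (hc : c ∈ P.coeff α) (i : {i : Fin D // i ∉ α}) :
    c i ∈ P.support := by
  simp only [support, mem_biUnion, mem_univ, true_and, mem_image]
  exact ⟨α, c, hc, i, rfl⟩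

open Classical in
/-- The polynomial on words over `Bool` given by a set-polynomial: it gives `true` to the
patterns obtained from the points of the coefficient of some `α` by putting variables at the
coordinates in `α`. -/
noncomputable def toWordPolynomial (P : SetPolynomial S D) : (Fin D → Option S) → Bool :=
  fun v => decide (∃ α : Finset (Fin D), (∀ i ∈ α, v i = none) ∧
    ∃ c ∈ P.coeff α, ∀ i : {i : Fin D // i ∉ α}, v i = some (c i))

section Words

variable [DecidableEq S] {P : SetPolynomial S D} {M n : Finset S} {U : Finset (Fin D → S)}
  {w : (Fin D → S) → Bool} {s : Fin D → S}

theorem eval_subset_cell (hP : P.HasEmptyConstantTerm) (hPM : P.support ⊆ M)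
    (hMn : Disjoint M n) : P.eval n ⊆ cell D M n := by
  intro s hs
  obtain ⟨α, hcoeff, hα⟩ := (P.mem_eval n s).mp hs
  obtain ⟨i, hi⟩ : α.Nonempty := by
    rw [nonempty_iff_ne_empty]
    rintro rfl
    rw [show P.coeff ∅ = ∅ from hP] at hcoeff
    exact notMem_empty _ hcoeff
  simp only [cell, mem_sdiff, mem_cube, mem_union]
  refine ⟨fun j => ?_, fun hM => Finset.disjoint_left.mp hMn (hM i) (hα i hi)⟩
  by_cases hj : j ∈ α
  · exact Or.inr (hα j hj)
  · exact Or.inl (hPM (mem_support hcoeff ⟨j, hj⟩))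

theorem toWordPolynomial_vary_iff (hPM : P.support ⊆ M) (hMn : Disjoint M n) :
    P.toWordPolynomial (vary n (some ∘ s)) = true ↔ s ∈ P.eval n := by
  have hnone (i : Fin D) : vary n (some ∘ s) i = none ↔ s i ∈ n := by simp [vary]
  have hsome (i : Fin D) (x : S) : vary n (some ∘ s) i = some x ↔ s i = x ∧ x ∉ n := by
    simp [vary]
  simp only [toWordPolynomial, mem_eval, decide_eq_true_eq, hnone, hsome]
  refine exists_congr fun α => ⟨?_, fun ⟨hcoeff, hα⟩ => ⟨hα, _, hcoeff, fun i => ⟨rfl, ?_⟩⟩⟩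
  · rintro ⟨hα, c, hc, hs⟩
    obtain rfl : (fun i : {i : Fin D // i ∉ α} => s i) = c := funext fun i => (hs i).1
    exact ⟨hc, hα⟩
  · exact Finset.disjoint_left.mp hMn (hPM (mem_support hcoeff i))

theorem disjoint_filter_overwrite_eval (hP : P.HasEmptyConstantTerm) (hPM : P.support ⊆ M)
    (hMn : Disjoint M n) :
    Disjoint {s ∈ U | overwrite M (fun _ => false) n w s = true} (P.eval n) := by
  rw [Finset.disjoint_right]
  intro s hs hsU
  have hfalse := (mem_filter.mp hsU).2
  rw [overwrite_apply_of_mem (eval_subset_cell hP hPM hMn hs)] at hfalse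
  exact Bool.false_ne_true hfalse

theorem filter_overwrite_union_eval (hP : P.HasEmptyConstantTerm) (hPM : P.support ⊆ M)
    (hMn : Disjoint M n) (hPU : P.eval n ⊆ U) :
    {s ∈ U | overwrite M (fun _ => false) n w s = true} ∪ P.eval n =
      {s ∈ U | overwrite M P.toWordPolynomial n w s = true} := by
  ext s
  have hU : s ∈ P.eval n → s ∈ U := fun h => hPU h
  simp only [mem_union, mem_filter]
  by_cases hs : s ∈ cell D M n
  · rw [overwrite_apply_of_mem hs, overwrite_apply_of_mem hs, toWordPolynomial_vary_iff hPM hMn]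
    tauto
  · have hsP : s ∉ P.eval n := fun h => hs (eval_subset_cell hP hPM hMn h)
    rw [overwrite_apply_of_notMem hs, overwrite_apply_of_notMem hs, or_iff_left hsP]

end Words

theorem isColoringRecurrent [Infinite S] {A : Finset (SetPolynomial S D)}
    (hA : ∀ P ∈ A, P.HasEmptyConstantTerm) : IsColoringRecurrent A := by
  classical
  intro k H
  let M : Finset S := H ∪ A.biUnion support
  obtain ⟨N, hMN, hN⟩ := isPartitionRegular M (fun _ => false)
    (toWordPolynomial '' (A : Set (SetPolynomial S D))) (ULift.{u} (Fin k))
  refine ⟨N, (hMN.mono_left subset_union_left).symm, fun ω => ?_⟩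
  let U := A.biUnion fun P => P.eval N
  obtain ⟨w, n, hnN, hn, hw⟩ := hN fun w => ⟨ω {s ∈ U | w s = true}⟩
  refine ⟨n, hnN, hn, {s ∈ U | overwrite M (fun _ => false) n w s = true}, filter_subset _ _,
    fun P hPA => ?_⟩
  have hPM : P.support ⊆ M := (subset_biUnion_of_mem support hPA).trans subset_union_right
  have hMn : Disjoint M n := hMN.mono_right hnN
  have hPU : P.eval n ⊆ U := (P.eval_mono hnN).trans (subset_biUnion_of_mem (eval · N) hPA)
  refine ⟨disjoint_filter_overwrite_eval (hA P hPA) hPM hMn, ?_⟩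
  have hcolor : ω {s ∈ U | overwrite M P.toWordPolynomial n w s = true} =
      ω {s ∈ U | overwrite M (fun _ => false) n w s = true} :=
    congrArg ULift.down (hw _ ⟨P, hPA, rfl⟩)
  rw [← filter_overwrite_union_eval (hA P hPA) hPM hMn hPU] at hcolor
  convert hcolor

end SetPolynomial

theorem exists_fin_coloring_dist_lt (X : Type*) [PseudoMetricSpace X] [CompactSpace X] {ε : ℝ}
    (hε : 0 < ε) : ∃ (k : ℕ) (f : X → Fin k), ∀ x y, f x = f y → dist x y < ε := by
  obtain ⟨t, -, htfin, ht⟩ := (isCompact_univ (X := X)).finite_cover_balls (half_pos hε)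
  have := htfin.fintype
  have hcenter (x : X) : ∃ c : t, dist x c < ε / 2 := by
    obtain ⟨c, hc, hx⟩ := Set.mem_iUnion₂.mp (ht (Set.mem_univ x))
    exact ⟨⟨c, hc⟩, hx⟩
  choose f hf using hcenter
  refine ⟨Fintype.card t, Fintype.equivFin t ∘ f, fun x y hxy => ?_⟩
  have hfxy : f x = f y := (Fintype.equivFin t).injective hxy
  calc dist x y ≤ dist x (f x) + dist y (f x) := dist_triangle_right x y _
    _ < ε / 2 + ε / 2 := add_lt_add (hf x) (hfxy ▸ hf y)
    _ = ε := add_halves ε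

theorem IsColoringRecurrent.isSystemOfRecurrence {S : Type u} {D : ℕ}
    {A : Finset (SetPolynomial S D)} (h : IsColoringRecurrent A) :
    IsSystemOfRecurrence.{u, v} A := by
  intro X _ _ T ε hε H
  obtain ⟨k, f, hf⟩ := exists_fin_coloring_dist_lt X hε
  obtain ⟨N, hNH, hN⟩ := h k H
  refine ⟨N, hNH, fun x => ?_⟩
  obtain ⟨n, hnN, hn, a, ha, hP⟩ := hN fun a => f (T.act a x)
  exact ⟨n, hnN, hn, a, ha, fun P hPA => ⟨(hP P hPA).1, hf _ _ (hP P hPA).2⟩⟩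

theorem theorem3p4 {S : Type u} [Infinite S] {D : ℕ} (hD : 0 < D)
    (A : Finset (SetPolynomial S D)) (hA : ∀ P ∈ A, P.HasEmptyConstantTerm) :
    IsSystemOfRecurrence.{u, v} A ∧ IsColoringRecurrent A :=
  have hcolor := SetPolynomial.isColoringRecurrent hA
  ⟨hcolor.isSystemOfRecurrence, hcolor⟩
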